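/- Let $0<\theta_1\le\theta_2\le\cdots$ be a non-decreasing sequence of positive real numbers, and let $\mathbb N$ denote the set of positive integers. For each $n$, the Luce model on the symmetric group $S_n$ with weights $\theta_1,\dots,\theta_n$ is the probability distribution $$\pi_n(\tau)=\prod_{i=1}^n \frac{\theta_{\tau(i)}}{w_n-\sum_{j<i}\theta_{\tau(j)}},\qquad w_n=\theta_1+\cdots+\theta_n,\quad \tau\in S_n .$$ Let $\sigma_n$ be the reverse of a random permutation $\tau_n$ drawn from $\pi_n$, that is, $\sigma_n(i)=\tau_n(n+1-i)$ for $1\le i\le n$, extended to a random element of $\mathbb N^{\mathbb N}$ by $\sigma_n(i)=i$ for $i>n$; here $\mathbb N^{\mathbb N}$ carries the topology of pointwise convergence. For $x\ge 0$ let $$f(x)=\sum_{i=1}^\infty e^{-\theta_i x}\in[0,\infty],\qquad x_0=\inf\{x\ge 0: f(x)<\infty\},$$ with $\inf\emptyset=\infty$. Then $\sigma_n$ converges in law on $\mathbb N^{\mathbb N}$ as $n\to\infty$ if and only if $x_0<\infty$ and $f(x_0)=\infty$. Moreover, if this condition holds, then the limiting finite-dimensional probability mass functions are given as follows: for every $k\ge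 1$ and all distinct positive integers $a_1,\dots,a_k$, $$\lim_{n\to\infty}P(\sigma_n(1)=a_1,\dots,\sigma_n(k)=a_k)=\int_{x_1>x_2>\cdots>x_k>0}\ \prod_{j=1}^k\theta_{a_j}e^{-\theta_{a_j}x_j}\prod_{i\notin\{a_1,\dots,a_k\}}\bigl(1-e^{-\theta_i x_k}\bigr)\,dx_1\cdots dx_k ,$$ where the integrand is integrable, and this number is also the probability that the limit law gives to the event that the first $k$ values are $a_1,\dots,a_k$. -/

import Mathlib

open MeasureTheory Filter Topology
open scoped ENNReal NNReal

/-! Positive integers are relabelled by `ℕ` (the positive integer `i` is written `i - 1`), for the balls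
as well as for the positions in a permutation. -/

noncomputable section

/-- The Luce probability of `σ`, where `σ i` is the `i`-th ball drawn: the product over `i` of
`θ (σ i)` divided by the total weight minus the weights of the balls drawn before step `i`. -/
def luceWeight {n : ℕ} (θ : Fin n → ℝ) (σ : Equiv.Perm (Fin n)) : ℝ :=
  ∏ i, θ (σ i) / ((∑ j, θ j) - ∑ j ∈ Finset.Iio i, θ (σ j))

theorem luceWeight_nonneg {n : ℕ} (θ : Fin n → ℝ) (hθ : ∀ i, 0 < θ i)
    (σ : Equiv.Perm (Fin n)) : 0 ≤ luceWeight θ σ := by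
  refine Finset.prod_nonneg fun i _ => div_nonneg (hθ _).le ?_
  rw [← Equiv.sum_comp σ θ, sub_nonneg]
  exact Finset.sum_le_sum_of_subset_of_nonneg (Finset.subset_univ _) fun j _ _ => (hθ _).le

theorem luceWeight_decomposeFin {n : ℕ} (θ : Fin (n + 1) → ℝ) (p : Fin (n + 1))
    (e : Equiv.Perm (Fin n)) :
    luceWeight θ (Equiv.Perm.decomposeFin.symm (p, e)) =
      θ p / (∑ j, θ j) * luceWeight (fun i => θ (Equiv.swap 0 p i.succ)) e := by
  have hs : ∑ j, θ j = θ p + ∑ i : Fin n, θ (Equiv.swap 0 p i.succ) := by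
    rw [← Equiv.sum_comp (Equiv.swap 0 p) θ, Fin.sum_univ_succ]
    simp
  unfold luceWeight
  rw [Fin.prod_univ_succ]
  congr 1
  · have : Finset.Iio (0 : Fin (n + 1)) = ∅ := by ext x; simp
    simp [this]
  · refine Finset.prod_congr rfl fun i _ => ?_
    have hI : ∑ j ∈ Finset.Iio i.succ, θ (Equiv.Perm.decomposeFin.symm (p, e) j) =
        θ p + ∑ j ∈ Finset.Iio i, θ (Equiv.swap 0 p (e j).succ) := by
      have h1 : Finset.Iio i.succ =
          insert 0 ((Finset.Iio i).map (Fin.succEmb n)) := by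
        ext x
        refine Fin.cases ?_ (fun y => ?_) x
        · simp
        · simp
      rw [h1, Finset.sum_insert (by simp), Finset.sum_map]
      simp
    rw [hI, hs]
    simp

theorem sum_luceWeight : ∀ {n : ℕ} (θ : Fin n → ℝ), (∀ i, 0 < θ i) →
    ∑ σ, luceWeight θ σ = 1
  | 0, θ, _ => by simp [luceWeight]
  | n + 1, θ, hθ => by
    rw [← Equiv.sum_comp Equiv.Perm.decomposeFin.symm, Fintype.sum_prod_type]
    simp only [luceWeight_decomposeFin, ← Finset.mul_sum]
    have h : ∀ p : Fin (n + 1),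
        ∑ e, luceWeight (fun i : Fin n => θ (Equiv.swap 0 p i.succ)) e = 1 :=
      fun p => sum_luceWeight _ fun i => hθ _
    simp only [h, mul_one, ← Finset.sum_div]
    exact div_self (Finset.sum_pos (fun i _ => hθ i) Finset.univ_nonempty).ne'

/-- The Luce model on `S_n`. -/
def lucePMF {n : ℕ} (θ : Fin n → ℝ) (hθ : ∀ i, 0 < θ i) : PMF (Equiv.Perm (Fin n)) :=
  PMF.ofFintype (fun σ => ENNReal.ofReal (luceWeight θ σ)) (by
    rw [← ENNReal.ofReal_sum_of_nonneg fun σ _ => luceWeight_nonneg θ hθ σ, sum_luceWeight θ hθ,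
      ENNReal.ofReal_one])

/-- The reverse of a permutation: its first value is the last value of `σ`, and so on. -/
def reversePerm {n : ℕ} (σ : Equiv.Perm (Fin n)) : Equiv.Perm (Fin n) :=
  Fin.revPerm.trans σ

/-- A permutation of the first `n` labels, extended to all labels by the identity. -/
def extendPerm {n : ℕ} (σ : Equiv.Perm (Fin n)) : ℕ → ℕ :=
  fun i => if h : i < n then (σ ⟨i, h⟩ : ℕ) else i

/-- The law, on the space of all maps `ℕ → ℕ` with the topology of pointwise convergence, of
the (extended) reverse of a Luce random permutation with weights `θ 0, …, θ (n - 1)`. -/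
def reverseLuceLaw (θ : ℕ → ℝ) (hθ : ∀ i, 0 < θ i) (n : ℕ) : ProbabilityMeasure (ℕ → ℕ) :=
  ⟨((lucePMF (fun i : Fin n => θ i) fun i => hθ i).map
    fun σ => extendPerm (reversePerm σ)).toMeasure, inferInstance⟩

/-- `f(x) = ∑ exp (-θ_i x)`, possibly infinite. -/
def expSum (θ : ℕ → ℝ) (x : ℝ≥0) : ℝ≥0∞ :=
  ∑' i, ENNReal.ofReal (Real.exp (-θ i * x))

/-- `x₀ = inf {x ≥ 0 : f(x) < ∞}`, with `inf ∅ = ∞`. -/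
def critPoint (θ : ℕ → ℝ) : ℝ≥0∞ :=
  sInf ((fun x : ℝ≥0 => (x : ℝ≥0∞)) '' {x | expSum θ x < ∞})

/-- The region `x_0 > x_1 > ⋯ > x_k > 0`. -/
def decreasingRegion (k : ℕ) : Set (Fin (k + 1) → ℝ) :=
  {x | StrictAnti x ∧ 0 < x (Fin.last k)}

/-- The integrand of the limiting mass function at `(a_0, …, a_k)`. On `decreasingRegion k` all
factors of the infinite product lie in `[0, 1]`, so that it converges unconditionally
(possibly to `0`). -/
def limitIntegrand (θ : ℕ → ℝ) {k : ℕ} (a : Fin (k + 1) → ℕ) (x : Fin (k + 1) → ℝ) : ℝ :=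
  (∏ j, θ (a j) * Real.exp (-θ (a j) * x j)) *
    ∏' i : {i : ℕ // i ∉ Set.range a}, (1 - Real.exp (-θ i * x (Fin.last k)))

/-- The maps whose first values are `a_0, …, a_k`. -/
def cylinderAt {k : ℕ} (a : Fin (k + 1) → ℕ) : Set (ℕ → ℕ) :=
  {s | ∀ j : Fin (k + 1), s j = a j}

end

/-! Sorting independent exponential variables `X i` of rates `θ i` into increasing order draws the
labels according to the Luce model, so the values of `σ_n` are the indices of `X 0, …, X (n - 1)`
in decreasing order of the variables.

If `f(x₀) = ∞`, the Borel–Cantelli lemmas give infinitely many `X i` above `x₀` but only finitely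
many above any `y > x₀`. The decreasing sort then stabilises almost surely, and the limit law is
that of the indices of the largest, second largest, … variable. Conversely a limit law forces the
sequence `X` to attain its supremum almost surely. This supremum is infinite if `x₀ = ∞` and at
least `x₀` if `x₀ < ∞`, while `f(x₀) < ∞` lets all variables be below `x₀` with
positive probability.

The mass of a cylinder converges to the probability that `X (a 0) > ⋯ > X (a k)` and that all other
variables are below `X (a k)`. -/

open ProbabilityTheory

noncomputable section

section Ranking

open Finset

variable {α : Type*} [LinearOrder α] {ω : ℕ → α} {n m i : ℕ}

/-- The indices `0, …, n - 1` listed by decreasing value of `ω`, followed by the remaining indices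
in their natural order. -/
def sortedIndices (n : ℕ) (ω : ℕ → α) : ℕ → ℕ :=
  extendPerm (reversePerm (Tuple.sort fun i : Fin n => ω i))

/-- The rank of `i` among the indices `0, …, n - 1` by decreasing value of `ω`, counted from `0`:
the inverse of `sortedIndices` when `ω` is injective. -/
def rankAmong (n : ℕ) (ω : ℕ → α) (i : ℕ) : ℕ :=
  #{j ∈ range n | ω i < ω j}

theorem sortedIndices_of_lt (ω : ℕ → α) (h : i < n) :
    sortedIndices n ω i = (Tuple.sort (fun i : Fin n => ω i) (Fin.rev ⟨i, h⟩) : Fin n) := by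
  simp [sortedIndices, extendPerm, reversePerm, h]

theorem sortedIndices_lt (ω : ℕ → α) (h : i < n) : sortedIndices n ω i < n := by
  rw [sortedIndices_of_lt ω h]
  exact Fin.is_lt _

theorem exists_sortedIndices_eq (ω : ℕ → α) (h : i < n) : ∃ m < n, sortedIndices n ω m = i := by
  refine ⟨Fin.rev ((Tuple.sort fun i : Fin n => ω i).symm ⟨i, h⟩), Fin.is_lt _, ?_⟩
  rw [sortedIndices_of_lt ω (Fin.is_lt _), Fin.eta, Fin.rev_rev, Equiv.apply_symm_apply]

theorem strictAntiOn_sortedIndices (hω : ω.Injective) :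
    StrictAntiOn (ω ∘ sortedIndices n ω) (Set.Iio n) := by
  intro i hi j hj hij
  have hsort : StrictMono ((fun i : Fin n => ω i) ∘ Tuple.sort fun i : Fin n => ω i) :=
    (Tuple.monotone_sort _).strictMono_of_injective
      ((hω.comp Fin.val_injective).comp (Equiv.injective _))
  rw [Function.comp_apply, Function.comp_apply, sortedIndices_of_lt ω hi, sortedIndices_of_lt ω hj]
  exact hsort (Fin.rev_lt_rev.2 hij)

theorem injOn_sortedIndices (hω : ω.Injective) : Set.InjOn (sortedIndices n ω) (Set.Iio n) :=
  (strictAntiOn_sortedIndices hω).injOn.of_comp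

theorem rankAmong_sortedIndices (hω : ω.Injective) (hm : m < n) :
    rankAmong n ω (sortedIndices n ω m) = m := by
  have himage : {j ∈ range n | ω (sortedIndices n ω m) < ω j} =
      (range m).image (sortedIndices n ω) := by
    ext j
    simp only [mem_filter, mem_range, mem_image]
    constructor
    · rintro ⟨hj, hlt⟩
      obtain ⟨l, hl, rfl⟩ := exists_sortedIndices_eq ω hj
      exact ⟨l, ((strictAntiOn_sortedIndices hω).lt_iff_gt hm hl).1 hlt, rfl⟩
    · rintro ⟨l, hl, rfl⟩
      have hln : l < n := hl.trans hm
      exact ⟨sortedIndices_lt ω hln, strictAntiOn_sortedIndices hω hln hm hl⟩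
  rw [rankAmong, himage, card_image_of_injOn, card_range]
  exact (injOn_sortedIndices hω).mono fun l hl => (mem_range.1 hl).trans hm

theorem sortedIndices_eq_iff (hω : ω.Injective) (hm : m < n) :
    sortedIndices n ω m = i ↔ i < n ∧ rankAmong n ω i = m := by
  constructor
  · rintro rfl
    exact ⟨sortedIndices_lt ω hm, rankAmong_sortedIndices hω hm⟩
  · rintro ⟨hi, rfl⟩
    obtain ⟨l, hl, rfl⟩ := exists_sortedIndices_eq ω hi
    rw [rankAmong_sortedIndices hω hl]

/-- The sequences whose `k + 1` largest values on `I ∪ {a 0, …, a k}` are, in decreasing order,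
those at `a 0, …, a k`. -/
def topEvent {k : ℕ} (a : Fin (k + 1) → ℕ) (I : Set ℕ) : Set (ℕ → α) :=
  {ω | StrictAnti (ω ∘ a) ∧ ∀ i ∈ I, i ∉ Set.range a → ω i < ω (a (Fin.last k))}

theorem rankAmong_of_mem_topEvent {k : ℕ} {a : Fin (k + 1) → ℕ} (han : ∀ j, a j < n)
    (h : ω ∈ topEvent a (Set.Iio n)) (j : Fin (k + 1)) : rankAmong n ω (a j) = j := by
  have himage : {i ∈ range n | ω (a j) < ω i} = (Iio j).image a := by
    ext i
    simp only [mem_filter, mem_range, mem_image, mem_Iio]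
    constructor
    · rintro ⟨hi, hlt⟩
      by_cases hia : i ∈ Set.range a
      · obtain ⟨l, rfl⟩ := hia
        exact ⟨l, h.1.lt_iff_gt.1 hlt, rfl⟩
      · have hlast : ω (a (Fin.last k)) ≤ ω (a j) := h.1.antitone (Fin.le_last j)
        exact absurd hlt ((h.2 i hi hia).trans_le hlast).not_gt
    · rintro ⟨l, hl, rfl⟩
      exact ⟨han l, h.1 hl⟩
  have ha : a.Injective := h.1.injective.of_comp
  rw [rankAmong, himage, card_image_of_injective _ ha, Fin.card_Iio]

theorem sortedIndices_mem_cylinderAt_iff (hω : ω.Injective) {k : ℕ} {a : Fin (k + 1) → ℕ}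
    (ha : a.Injective) (han : ∀ j, a j < n) :
    sortedIndices n ω ∈ cylinderAt a ↔ ω ∈ topEvent a (Set.Iio n) := by
  have hkn : k < n := by
    simpa using Fintype.card_le_of_injective (fun j => (⟨a j, han j⟩ : Fin n))
      fun i j h => ha (by simpa using h)
  have hjn (j : Fin (k + 1)) : (j : ℕ) < n := (Nat.le_of_lt_succ j.2).trans_lt hkn
  constructor
  · intro h
    refine ⟨fun i j hij => ?_, fun i hi hia => ?_⟩
    · simpa only [Function.comp_apply, h i, h j] using
        strictAntiOn_sortedIndices hω (hjn i) (hjn j) hij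
    · obtain ⟨m, hm, rfl⟩ := exists_sortedIndices_eq ω hi
      have hkm : k < m := by
        by_contra! hmk
        exact hia ⟨⟨m, Nat.lt_succ_of_le hmk⟩, (h _).symm⟩
      simpa only [Function.comp_apply, h (Fin.last k)] using
        strictAntiOn_sortedIndices hω (hjn (Fin.last k)) hm hkm
  · exact fun h j => (sortedIndices_eq_iff hω (hjn j)).2 ⟨han j, rankAmong_of_mem_topEvent han h j⟩

theorem exists_tendsto_sortedIndices (hω : ω.Injective) {c : α} (hinf : {i | c < ω i}.Infinite)
    (hfin : ∀ y > c, {i | y < ω i}.Finite) :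
    ∃ s, Tendsto (fun n => sortedIndices n ω) atTop (𝓝 s) := by
  suffices h : ∀ k, ∃ i, ∀ᶠ n in atTop, sortedIndices n ω k = i by
    choose s hs using h
    exact ⟨s, tendsto_pi_nhds.2 fun k => tendsto_nhds_of_eventually_eq (hs k)⟩
  intro k
  obtain ⟨t, htc, htk⟩ := hinf.exists_subset_card_eq (k + 1)
  obtain ⟨i₀, hi₀, hmin⟩ := t.exists_min_image ω (card_pos.1 (by omega))
  have habove : {j | ω i₀ ≤ ω j}.Finite := ((hfin _ (htc hi₀)).insert i₀).subset fun j hj =>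
    (eq_or_lt_of_le hj).imp (fun h => (hω h).symm) id
  obtain ⟨M, hM⟩ := habove.bddAbove
  set N := M + 1
  have hlt_N {j : ℕ} (hj : ω i₀ ≤ ω j) : j < N := Nat.lt_succ_of_le (hM hj)
  have hkN : k < N := by
    have := card_le_card fun j hj => mem_range.2 (hlt_N (hmin j hj))
    rw [card_range] at this
    omega
  have hi : ω i₀ ≤ ω (sortedIndices N ω k) := by
    by_contra! hlt
    have := card_le_card fun j hj => mem_filter.2
      ⟨mem_range.2 (hlt_N (hmin j hj)), hlt.trans_le (hmin j hj)⟩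
    rw [← rankAmong, rankAmong_sortedIndices hω hkN] at this
    omega
  refine ⟨sortedIndices N ω k, ?_⟩
  filter_upwards [eventually_ge_atTop N] with n hn
  refine (sortedIndices_eq_iff hω (hkN.trans_le hn)).2 ⟨(hlt_N hi).trans_le hn, ?_⟩
  refine Eq.trans ?_ (rankAmong_sortedIndices hω hkN)
  rw [rankAmong, rankAmong]
  congr 1 with j
  simp only [mem_filter, mem_range, and_congr_left_iff]
  exact fun hj => ⟨fun _ => hlt_N (hi.trans hj.le), fun h => h.trans_le hn⟩

end Ranking
section FinProduct

variable {X : Type*} [MeasurableSpace X] {n : ℕ}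

theorem measurable_vecCons :
    Measurable fun p : X × (Fin n → X) => (Matrix.vecCons p.1 p.2 : Fin (n + 1) → X) := by
  refine measurable_pi_lambda _ fun i => ?_
  refine i.cases ?_ fun j => ?_
  · exact measurable_fst
  · exact (measurable_pi_apply j).comp measurable_snd

theorem lintegral_pi_succ (ν : Fin (n + 1) → Measure X) [∀ i, SigmaFinite (ν i)]
    {f : (Fin (n + 1) → X) → ℝ≥0∞} (hf : Measurable f) :
    ∫⁻ x, f x ∂Measure.pi ν =
      ∫⁻ t, ∫⁻ y, f (Matrix.vecCons t y) ∂Measure.pi (fun i => ν i.succ) ∂ν 0 := by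
  have hpres := (measurePreserving_piFinSuccAbove ν 0).symm
  rw [← hpres.lintegral_comp hf]
  refine (lintegral_prod _ (hf.comp hpres.measurable).aemeasurable).trans ?_
  simp [MeasurableEquiv.piFinSuccAbove, Fin.insertNthEquiv, Matrix.vecCons]

theorem pi_succ_apply (ν : Fin (n + 1) → Measure X) [∀ i, SigmaFinite (ν i)]
    {s : Set (Fin (n + 1) → X)} (hs : MeasurableSet s) :
    Measure.pi ν s =
      ∫⁻ t, Measure.pi (fun i => ν i.succ) {y | Matrix.vecCons t y ∈ s} ∂ν 0 := by
  rw [← lintegral_indicator_one hs, lintegral_pi_succ ν (measurable_one.indicator hs)]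
  exact lintegral_congr fun t =>
    lintegral_indicator_one (hs.preimage (measurable_vecCons.comp measurable_prodMk_left))

theorem lintegral_pi_prod : ∀ {n : ℕ} (ν : Fin n → Measure X) [∀ i, SigmaFinite (ν i)]
    {g : Fin n → X → ℝ≥0∞}, (∀ i, Measurable (g i)) →
    ∫⁻ x, ∏ i, g i (x i) ∂Measure.pi ν = ∏ i, ∫⁻ t, g i t ∂ν i
  | 0, ν, _, g, _ => by simp [Measure.pi_of_empty ν Fin.elim0]
  | n + 1, ν, _, g, hg => by
    have htail : Measurable fun y : Fin n → X => ∏ i, g i.succ (y i) :=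
      Finset.measurable_fun_prod _ fun i _ => (hg i.succ).comp (measurable_pi_apply i)
    have hprod : Measurable fun x : Fin (n + 1) → X => ∏ i, g i (x i) :=
      Finset.measurable_fun_prod _ fun i _ => (hg i).comp (measurable_pi_apply i)
    rw [lintegral_pi_succ ν hprod]
    simp only [Fin.prod_univ_succ, Matrix.cons_val_zero, Matrix.cons_val_succ]
    simp_rw [lintegral_const_mul _ htail]
    rw [lintegral_mul_const _ (hg 0), lintegral_pi_prod _ fun i => hg i.succ]

theorem pi_withDensity (ν : Fin n → Measure X) [∀ i, SigmaFinite (ν i)] {g : Fin n → X → ℝ≥0∞}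
    (hg : ∀ i, Measurable (g i)) [∀ i, SigmaFinite ((ν i).withDensity (g i))] :
    Measure.pi (fun i => (ν i).withDensity (g i)) =
      (Measure.pi ν).withDensity fun x => ∏ i, g i (x i) := by
  refine Measure.pi_eq fun s hs => ?_
  have hind (x : Fin n → X) : (Set.univ.pi s).indicator (fun x => ∏ i, g i (x i)) x =
      ∏ i, (s i).indicator (g i) (x i) := by
    by_cases hx : x ∈ Set.univ.pi s
    · rw [Set.indicator_of_mem hx]
      exact Finset.prod_congr rfl fun i _ => (Set.indicator_of_mem (hx i trivial) _).symm
    · rw [Set.indicator_of_notMem hx]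
      simp only [Set.mem_univ_pi, not_forall] at hx
      obtain ⟨i, hi⟩ := hx
      exact (Finset.prod_eq_zero (Finset.mem_univ i) (Set.indicator_of_notMem hi _)).symm
  rw [withDensity_apply _ (.univ_pi hs), ← lintegral_indicator (.univ_pi hs)]
  simp_rw [hind]
  rw [lintegral_pi_prod ν fun i => (hg i).indicator (hs i)]
  refine Finset.prod_congr rfl fun i _ => ?_
  rw [lintegral_indicator (hs i), withDensity_apply _ (hs i)]

end FinProduct

theorem toReal_tprod_of_le_one {ι : Type*} {p : ι → ℝ≥0∞} (hp : ∀ i, p i ≤ 1) :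
    (∏' i, p i).toReal = ∏' i, (p i).toReal := by
  have hne : ∏' i, p i ≠ ∞ := by
    rw [ENNReal.tprod_eq_iInf_prod hp]
    exact ((iInf_le _ ∅).trans_lt (by simp)).ne
  have hlim : HasProd (fun i => (p i).toReal) (∏' i, p i).toReal :=
    ((ENNReal.tendsto_toReal hne).comp (ENNReal.multipliable_of_le_one hp).hasProd).congr
      fun t => ENNReal.toReal_prod t p
  exact hlim.tprod_eq.symm

section InfiniteProduct

variable {ι X : Type*} [MeasurableSpace X] {ν : ι → Measure X} [∀ i, IsProbabilityMeasure (ν i)]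
  {s : ι → Set X}

theorem infinitePi_setOf_apply_mem (i : ι) (hs : MeasurableSet (s i)) :
    Measure.infinitePi ν {ω | ω i ∈ s i} = ν i (s i) :=
  (measurePreserving_eval_infinitePi ν i).measure_preimage hs.nullMeasurableSet

theorem ae_infinitePi_ne [Countable ι] [∀ i, NullSingletonClass (ν i)] (c : X) :
    ∀ᵐ ω ∂Measure.infinitePi ν, ∀ i, ω i ≠ c :=
  ae_all_iff.2 fun i =>
    (measurePreserving_eval_infinitePi ν i).quasiMeasurePreserving.ae ((ν i).ae_ne c)

theorem ae_infinitePi_injective [Countable ι] [MeasurableEq X]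
    [∀ i, NullSingletonClass (ν i)] :
    ∀ᵐ ω ∂Measure.infinitePi ν, Function.Injective ω := by
  have hne {i j : ι} (hij : i ≠ j) : ∀ᵐ ω ∂Measure.infinitePi ν, ω i ≠ ω j := by
    refine ae_of_ae_map (f := fun ω : ι → X => (ω i, ω j)) (p := fun p => p.1 ≠ p.2)
      (by fun_prop) ?_
    rw [Measure.infinitePi_map_eval_prod hij, Measure.ae_prod_iff_ae_ae (p := fun p => p.1 ≠ p.2)
      (measurableSet_eq_fun measurable_fst measurable_snd).compl]
    exact .of_forall fun x => ((ν j).ae_ne x).mono fun y hy => hy.symm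
  have hall : ∀ᵐ ω ∂Measure.infinitePi ν, ∀ i j, i ≠ j → ω i ≠ ω j :=
    ae_all_iff.2 fun i => ae_all_iff.2 fun j => eventually_imp_distrib_left.2 hne
  filter_upwards [hall] with ω hω i j
  exact not_imp_not.1 (hω i j)

theorem ae_infinitePi_setOf_mem_finite [Countable ι] (hs : ∀ i, MeasurableSet (s i))
    (hsum : ∑' i, ν i (s i) ≠ ∞) : ∀ᵐ ω ∂Measure.infinitePi ν, {i | ω i ∈ s i}.Finite :=
  ae_finite_setOfPred_mem (s := fun i => {ω : ι → X | ω i ∈ s i})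
    (by simpa only [infinitePi_setOf_apply_mem _ (hs _)] using hsum)

theorem ae_infinitePi_setOf_mem_infinite {ν : ℕ → Measure X} [∀ i, IsProbabilityMeasure (ν i)]
    {s : ℕ → Set X} (hs : ∀ i, MeasurableSet (s i))
    (hsum : ∑' i, ν i (s i) = ∞) : ∀ᵐ ω ∂Measure.infinitePi ν, {i | ω i ∈ s i}.Infinite := by
  let A (i : ℕ) : Set (ℕ → X) := {ω | ω i ∈ s i}
  have hA (i : ℕ) : MeasurableSet (A i) := (hs i).preimage (measurable_pi_apply i)
  have hindep : iIndepSet A (Measure.infinitePi ν) := by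
    refine (iIndepSet_iff_meas_biInter hA).2 fun t => ?_
    have hpi : ⋂ i ∈ t, A i = Set.pi t s := by ext; simp [A]
    rw [hpi, Measure.infinitePi_pi _ fun i _ => hs i]
    exact Finset.prod_congr rfl fun i _ => (infinitePi_setOf_apply_mem i (hs i)).symm
  have hlimsup : Measure.infinitePi ν (limsup A atTop) = 1 :=
    measure_limsup_eq_one hA hindep
      (by simpa only [A, infinitePi_setOf_apply_mem _ (hs _)] using hsum)
  filter_upwards [(mem_ae_iff_prob_eq_one (.measurableSet_limsup hA)).2 hlimsup] with ω hω
  exact Nat.frequently_atTop_iff_infinite.1 (mem_limsup_iff_frequently_mem.1 hω)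

theorem infinitePi_univ_pi_ne_zero [Countable ι] (hs : ∀ i, MeasurableSet (s i))
    (hpos : ∀ i, ν i (s i) ≠ 0) (hsum : ∑' i, ν i (s i)ᶜ ≠ ∞) :
    Measure.infinitePi ν (Set.univ.pi s) ≠ 0 := by
  have hreal (i : ι) : 1 + -(ν i).real (s i)ᶜ = (ν i).real (s i) := by
    rw [probReal_compl_eq_one_sub (hs i), neg_sub, add_sub_cancel]
  rw [Measure.infinitePi_pi_univ _ hs]
  intro hzero
  have hprod : ∏' i, (1 + -(ν i).real (s i)ᶜ) = 0 := by
    simp_rw [hreal, measureReal_def]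
    rw [← toReal_tprod_of_le_one fun _ => prob_le_one, hzero, ENNReal.toReal_zero]
  refine tprod_one_add_ne_zero_of_summable (fun i => ?_) ?_ hprod
  · rw [hreal]
    exact (ENNReal.toReal_pos (hpos i) (measure_ne_top _ _)).ne'
  · simp_rw [norm_neg, Real.norm_of_nonneg measureReal_nonneg]
    exact ENNReal.summable_toReal hsum

end InfiniteProduct
section Exponential

variable {r x : ℝ}

theorem expMeasure_eq_withDensity (r : ℝ) :
    expMeasure r = volume.withDensity (exponentialPDF r) := rfl

theorem measurable_exponentialPDF (r : ℝ) : Measurable (exponentialPDF r) :=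
  (measurable_exponentialPDFReal r).ennreal_ofReal

instance nullSingletonClass_expMeasure (r : ℝ) : NullSingletonClass (expMeasure r) := by
  rw [expMeasure_eq_withDensity]
  infer_instance

theorem expMeasure_Iic (hr : 0 < r) (hx : 0 ≤ x) :
    expMeasure r (Set.Iic x) = ENNReal.ofReal (1 - Real.exp (-r * x)) := by
  rw [expMeasure_eq_withDensity, withDensity_apply _ measurableSet_Iic,
    lintegral_exponentialPDF_eq_antiDeriv hr, if_pos hx, neg_mul]

theorem expMeasure_Ioi (hr : 0 < r) (hx : 0 ≤ x) :
    expMeasure r (Set.Ioi x) = ENNReal.ofReal (Real.exp (-r * x)) := by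
  have := isProbabilityMeasure_expMeasure hr
  have hle : Real.exp (-r * x) ≤ 1 := Real.exp_le_one_iff.2 (by nlinarith)
  rw [← Set.compl_Iic, prob_compl_eq_one_sub measurableSet_Iic, expMeasure_Iic hr hx,
    ← ENNReal.ofReal_one, ← ENNReal.ofReal_sub _ (sub_nonneg.2 hle), sub_sub_cancel]

theorem expMeasure_ae_pos (hr : 0 < r) : ∀ᵐ x ∂expMeasure r, 0 < x := by
  have hzero : expMeasure r (Set.Iic 0) = 0 := by simp [expMeasure_Iic hr le_rfl]
  filter_upwards [measure_eq_zero_iff_ae_notMem.1 hzero] with x hx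
  exact not_le.1 hx

theorem exponentialPDF_mul_exp {s : ℝ} (hr : 0 < r) (hs : 0 ≤ s) (hx : 0 ≤ x) :
    exponentialPDF r x * ENNReal.ofReal (Real.exp (-x * s)) =
      ENNReal.ofReal (r / (r + s)) * exponentialPDF (r + s) x := by
  have hexp : Real.exp (-(r * x)) * Real.exp (-x * s) = Real.exp (-((r + s) * x)) := by
    rw [← Real.exp_add]
    ring_nf
  rw [exponentialPDF_of_nonneg hx, exponentialPDF_of_nonneg hx,
    ← ENNReal.ofReal_mul (by positivity), ← ENNReal.ofReal_mul (by positivity), mul_assoc, hexp,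
    ← mul_assoc, div_mul_cancel₀ _ (by positivity)]

theorem setLIntegral_Ioi_exp_expMeasure {s t : ℝ} (hr : 0 < r) (hs : 0 ≤ s) (ht : 0 ≤ t) :
    ∫⁻ x in Set.Ioi t, ENNReal.ofReal (Real.exp (-x * s)) ∂expMeasure r =
      ENNReal.ofReal (Real.exp (-t * (r + s)) * (r / (r + s))) := by
  rw [expMeasure_eq_withDensity, setLIntegral_withDensity_eq_setLIntegral_mul _
    (measurable_exponentialPDF r) (by fun_prop) measurableSet_Ioi]
  calc ∫⁻ x in Set.Ioi t, exponentialPDF r x * ENNReal.ofReal (Real.exp (-x * s))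
      = ∫⁻ x in Set.Ioi t, ENNReal.ofReal (r / (r + s)) * exponentialPDF (r + s) x :=
        setLIntegral_congr_fun measurableSet_Ioi fun x hx =>
          exponentialPDF_mul_exp hr hs (ht.trans (le_of_lt hx))
    _ = ENNReal.ofReal (r / (r + s)) * expMeasure (r + s) (Set.Ioi t) := by
        rw [lintegral_const_mul _ (measurable_exponentialPDF _), expMeasure_eq_withDensity,
          withDensity_apply _ measurableSet_Ioi]
    _ = ENNReal.ofReal (Real.exp (-t * (r + s)) * (r / (r + s))) := by
        rw [expMeasure_Ioi (by positivity) ht, ← ENNReal.ofReal_mul (by positivity), neg_mul_comm,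
          mul_comm, mul_comm _ (-t)]

theorem measurable_prod_exponentialPDF {n : ℕ} (c : Fin n → ℝ) :
    Measurable fun x : Fin n → ℝ => ∏ j, exponentialPDF (c j) (x j) :=
  Finset.measurable_fun_prod _ fun j _ =>
    (measurable_exponentialPDF _).comp (measurable_pi_apply j)

theorem pi_expMeasure_eq_withDensity {n : ℕ} {c : Fin n → ℝ} (hc : ∀ j, 0 < c j) :
    Measure.pi (fun j => expMeasure (c j)) =
      volume.withDensity fun x => ∏ j, exponentialPDF (c j) (x j) := by
  have (j : Fin n) : IsProbabilityMeasure (volume.withDensity (exponentialPDF (c j))) :=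
    isProbabilityMeasure_expMeasure (hc j)
  exact pi_withDensity (g := fun j => exponentialPDF (c j)) _ fun j => measurable_exponentialPDF _

end Exponential

section LuceModel

theorem measurableSet_strictMono {ι : Type*} [Preorder ι] [Countable ι] :
    MeasurableSet {x : ι → ℝ | StrictMono x} := by
  refine measurableSet_setOfPred.2 (Measurable.forall fun i => Measurable.forall fun j => ?_)
  exact Measurable.imp measurable_const
    (measurableSet_setOfPred.1 (measurableSet_lt (by fun_prop) (by fun_prop)))

theorem measurableSet_strictAnti {ι : Type*} [Preorder ι] [Countable ι] :
    MeasurableSet {x : ι → ℝ | StrictAnti x} := by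
  refine measurableSet_setOfPred.2 (Measurable.forall fun i => Measurable.forall fun j => ?_)
  exact Measurable.imp measurable_const
    (measurableSet_setOfPred.1 (measurableSet_lt (by fun_prop) (by fun_prop)))

theorem measurableSet_strictMono_vecCons {n : ℕ} (t : ℝ) :
    MeasurableSet {x : Fin n → ℝ | StrictMono (Matrix.vecCons t x)} :=
  measurableSet_strictMono.preimage (measurable_vecCons.comp measurable_prodMk_left)

theorem luceWeight_eq_luceWeight_comp_one {n : ℕ} (θ : Fin n → ℝ) (τ : Equiv.Perm (Fin n)) :
    luceWeight θ τ = luceWeight (θ ∘ τ) 1 := by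
  simp only [luceWeight, Equiv.Perm.coe_one, id_eq, Function.comp_apply, Equiv.sum_comp τ θ]

theorem luceWeight_one_succ {n : ℕ} (c : Fin (n + 1) → ℝ) :
    luceWeight c 1 = c 0 / (∑ j, c j) * luceWeight (fun i => c i.succ) 1 := by
  simpa [Equiv.Perm.one_def] using luceWeight_decomposeFin c 0 1

-- The lower bound `t` makes the claim inductive.
theorem pi_expMeasure_strictMono_vecCons : ∀ {n : ℕ} (c : Fin n → ℝ), (∀ i, 0 < c i) →
    ∀ t : ℝ, 0 ≤ t →
      Measure.pi (fun i => expMeasure (c i)) {x | StrictMono (Matrix.vecCons t x)} =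
        ENNReal.ofReal (Real.exp (-t * ∑ i, c i) * luceWeight c 1)
  | 0, c, _, t, _ => by
    simp [luceWeight, Subsingleton.strictMono]
  | n + 1, c, hc, t, ht => by
    have := fun i => isProbabilityMeasure_expMeasure (hc i)
    have hsum : 0 ≤ ∑ i : Fin n, c i.succ := Finset.sum_nonneg fun i _ => (hc _).le
    have hsection (x : ℝ) : Measure.pi (fun i : Fin n => expMeasure (c i.succ))
        {y | StrictMono (Matrix.vecCons t (Matrix.vecCons x y))} =
        (Set.Ioi t).indicator (fun x => ENNReal.ofReal (Real.exp (-x * ∑ i : Fin n, c i.succ)) *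
          ENNReal.ofReal (luceWeight (fun i => c i.succ) 1)) x := by
      simp only [strictMono_vecCons (a := t), Matrix.cons_val_zero, Set.indicator_apply,
        Set.mem_Ioi]
      split_ifs with hx
      · simp only [hx, true_and]
        rw [pi_expMeasure_strictMono_vecCons _ (fun i => hc _) x (ht.trans hx.le),
          ENNReal.ofReal_mul (Real.exp_nonneg _)]
      · simp [hx]
    rw [pi_succ_apply _ (measurableSet_strictMono_vecCons t)]
    simp only [Set.mem_ofPred_eq, hsection]
    rw [lintegral_indicator measurableSet_Ioi, lintegral_mul_const _ (by fun_prop),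
      setLIntegral_Ioi_exp_expMeasure (hc 0) hsum ht, ← ENNReal.ofReal_mul, luceWeight_one_succ,
      Fin.sum_univ_succ, mul_assoc]
    have := hc 0
    positivity

theorem sort_eq_iff_strictMono {α : Type*} [LinearOrder α] {n : ℕ} {x : Fin n → α}
    (hx : x.Injective) (τ : Equiv.Perm (Fin n)) : Tuple.sort x = τ ↔ StrictMono (x ∘ τ) := by
  rw [eq_comm, Tuple.eq_sort_iff]
  exact ⟨fun h => h.1.strictMono_of_injective (hx.comp τ.injective),
    fun h => ⟨h.monotone, fun i j hij heq => absurd heq (h hij).ne⟩⟩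

theorem strictMono_vecCons_zero_iff {n : ℕ} {x : Fin n → ℝ} (hx : ∀ i, 0 < x i) :
    StrictMono (Matrix.vecCons 0 x) ↔ StrictMono x := by
  cases n with
  | zero => simp [Subsingleton.strictMono]
  | succ n => simp [strictMono_vecCons, hx]

local instance permMeasurableSpace {n : ℕ} : MeasurableSpace (Equiv.Perm (Fin n)) := ⊤

local instance permDiscreteMeasurableSpace {n : ℕ} :
    DiscreteMeasurableSpace (Equiv.Perm (Fin n)) :=
  ⟨fun _ => trivial⟩

theorem measurable_tupleSort {n : ℕ} : Measurable (fun x : Fin n → ℝ => Tuple.sort x) := by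
  refine measurable_to_countable' fun τ => ?_
  have hfiber : (fun x : Fin n → ℝ => Tuple.sort x) ⁻¹' {τ} =
      {x | (∀ i j, i ≤ j → x (τ i) ≤ x (τ j)) ∧
        ∀ i j, i < j → x (τ i) = x (τ j) → τ i < τ j} :=
    Set.ext fun x => eq_comm.trans Tuple.eq_sort_iff
  rw [hfiber]
  measurability

theorem measurable_sortedIndices (n : ℕ) : Measurable (sortedIndices (α := ℝ) n) :=
  (Measurable.of_discrete (f := fun τ : Equiv.Perm (Fin n) => extendPerm (reversePerm τ))).comp
    (measurable_tupleSort.comp (by fun_prop : Measurable fun (ω : ℕ → ℝ) (i : Fin n) => ω i))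

/-- The law of a sequence of independent exponential variables with rates `θ i`. -/
def expProduct (θ : ℕ → ℝ) : Measure (ℕ → ℝ) :=
  Measure.infinitePi fun i => expMeasure (θ i)

variable {θ : ℕ → ℝ} (hθ : ∀ i, 0 < θ i)

include hθ

theorem isProbabilityMeasure_expProduct : IsProbabilityMeasure (expProduct θ) := by
  have := fun i => isProbabilityMeasure_expMeasure (hθ i)
  exact inferInstanceAs (IsProbabilityMeasure (Measure.infinitePi fun i => expMeasure (θ i)))

theorem expProduct_map_comp {n : ℕ} {f : Fin n → ℕ} (hf : f.Injective) :
    (expProduct θ).map (fun ω i => ω (f i)) = Measure.pi fun i => expMeasure (θ (f i)) := by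
  have := fun i => isProbabilityMeasure_expMeasure (hθ i)
  rw [expProduct, Measure.map_infinitePi_infinitePi_of_inj hf, Measure.infinitePi_eq_pi]

theorem ae_expProduct_pos : ∀ᵐ ω ∂expProduct θ, ∀ i, 0 < ω i := by
  have := fun i => isProbabilityMeasure_expMeasure (hθ i)
  exact ae_all_iff.2 fun i => (measurePreserving_eval_infinitePi
    (fun i => expMeasure (θ i)) i).quasiMeasurePreserving.ae (expMeasure_ae_pos (hθ i))

theorem ae_expProduct_injective : ∀ᵐ ω ∂expProduct θ, Function.Injective ω := by
  have := fun i => isProbabilityMeasure_expMeasure (hθ i)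
  exact ae_infinitePi_injective

theorem expProduct_sort_eq {n : ℕ} (τ : Equiv.Perm (Fin n)) :
    expProduct θ {ω | Tuple.sort (fun i : Fin n => ω i) = τ} =
      ENNReal.ofReal (luceWeight (fun i : Fin n => θ i) τ) := by
  have hsort : {ω : ℕ → ℝ | Tuple.sort (fun i : Fin n => ω i) = τ} =ᵐ[expProduct θ]
      (fun (ω : ℕ → ℝ) (i : Fin n) => ω (τ i : ℕ)) ⁻¹' {x | StrictMono (Matrix.vecCons 0 x)} := by
    rw [eventuallyEq_set]
    filter_upwards [ae_expProduct_injective hθ, ae_expProduct_pos hθ] with ω hinj hpos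
    exact (sort_eq_iff_strictMono (hinj.comp Fin.val_injective) τ).trans
      (strictMono_vecCons_zero_iff fun i => hpos _).symm
  rw [measure_congr hsort, ← Measure.map_apply (by fun_prop) (measurableSet_strictMono_vecCons 0),
    expProduct_map_comp hθ (f := fun i => (τ i : ℕ)) (Fin.val_injective.comp τ.injective),
    pi_expMeasure_strictMono_vecCons _ (fun i => hθ _) 0 le_rfl,
    luceWeight_eq_luceWeight_comp_one (fun i : Fin n => θ i) τ]
  simp [Function.comp_def]

theorem reverseLuceLaw_eq_map (n : ℕ) :
    (reverseLuceLaw θ hθ n : Measure (ℕ → ℕ)) = (expProduct θ).map (sortedIndices n) := by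
  have hsort : Measurable fun ω : ℕ → ℝ => Tuple.sort fun i : Fin n => ω i :=
    measurable_tupleSort.comp (by fun_prop : Measurable fun (ω : ℕ → ℝ) (i : Fin n) => ω i)
  have hluce : (lucePMF (fun i : Fin n => θ i) fun i => hθ i).toMeasure =
      (expProduct θ).map fun ω => Tuple.sort fun i : Fin n => ω i := by
    refine Measure.ext_of_singleton fun τ => ?_
    rw [PMF.toMeasure_apply_singleton _ _ (measurableSet_singleton τ),
      Measure.map_apply hsort (measurableSet_singleton τ)]
    exact (expProduct_sort_eq hθ τ).symm
  change ((lucePMF (fun i : Fin n => θ i) fun i => hθ i).map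
    fun σ => extendPerm (reversePerm σ)).toMeasure = _
  rw [← PMF.toMeasure_map (hf := .of_discrete), hluce, Measure.map_map .of_discrete hsort]
  rfl

end LuceModel

section CriticalPoint

variable {θ : ℕ → ℝ} {x : ℝ≥0}

theorem expSum_zero (θ : ℕ → ℝ) : expSum θ 0 = ∞ := by
  simp [expSum]

theorem expSum_eq_top_of_lt_critPoint (hx : x < critPoint θ) : expSum θ x = ∞ := by
  by_contra h
  exact absurd (sInf_le ⟨x, lt_top_iff_ne_top.2 h, rfl⟩ : critPoint θ ≤ x) (not_le.2 hx)

variable (hθ : ∀ i, 0 < θ i)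

include hθ

theorem antitone_expSum : Antitone (expSum θ) := by
  intro x y hxy
  refine ENNReal.tsum_le_tsum fun i => ENNReal.ofReal_le_ofReal (Real.exp_le_exp.2 ?_)
  exact mul_le_mul_of_nonpos_left (NNReal.coe_le_coe.2 hxy) (neg_nonpos.2 (hθ i).le)

theorem expSum_lt_top_of_critPoint_lt (hx : critPoint θ < x) : expSum θ x < ∞ := by
  obtain ⟨_, ⟨y, hy, rfl⟩, hyx⟩ := sInf_lt_iff.1 hx
  exact (antitone_expSum hθ (ENNReal.coe_lt_coe.1 hyx).le).trans_lt hy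

theorem tsum_expMeasure_Ioi (x : ℝ≥0) : ∑' i, expMeasure (θ i) (Set.Ioi x) = expSum θ x :=
  tsum_congr fun i => expMeasure_Ioi (hθ i) x.coe_nonneg

theorem ae_expProduct_setOf_lt_infinite (hx : expSum θ x = ∞) :
    ∀ᵐ ω ∂expProduct θ, {i | (x : ℝ) < ω i}.Infinite := by
  have := fun i => isProbabilityMeasure_expMeasure (hθ i)
  exact ae_infinitePi_setOf_mem_infinite (fun _ => measurableSet_Ioi)
    ((tsum_expMeasure_Ioi hθ x).trans hx)

theorem ae_expProduct_setOf_lt_finite (hx : expSum θ x < ∞) :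
    ∀ᵐ ω ∂expProduct θ, {i | (x : ℝ) < ω i}.Finite := by
  have := fun i => isProbabilityMeasure_expMeasure (hθ i)
  exact ae_infinitePi_setOf_mem_finite (fun _ => measurableSet_Ioi)
    ((tsum_expMeasure_Ioi hθ x).trans_lt hx).ne

theorem ae_expProduct_exists_lt_of_lt_critPoint :
    ∀ᵐ ω ∂expProduct θ, ∀ y : ℝ, ENNReal.ofReal y < critPoint θ → ∃ i, y < ω i := by
  have hrat (q : ℚ) : ∀ᵐ ω ∂expProduct θ, ENNReal.ofReal q < critPoint θ → ∃ i, (q : ℝ) < ω i := by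
    refine eventually_imp_distrib_left.2 fun hq => ?_
    filter_upwards [ae_expProduct_setOf_lt_infinite hθ (expSum_eq_top_of_lt_critPoint hq)]
      with ω hω
    obtain ⟨i, hi⟩ := hω.nonempty
    exact ⟨i, (Real.le_coe_toNNReal _).trans_lt hi⟩
  filter_upwards [ae_all_iff.2 hrat] with ω hω y hy
  obtain ⟨q, -, hyq, hq⟩ := ENNReal.lt_iff_exists_rat_btwn.1 hy
  obtain ⟨i, hi⟩ := hω q hq
  exact ⟨i, (lt_of_not_ge fun h => hyq.not_ge (ENNReal.ofReal_le_ofReal h)).trans hi⟩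

theorem ae_expProduct_setOf_lt_finite_of_critPoint_lt :
    ∀ᵐ ω ∂expProduct θ, ∀ y : ℝ, critPoint θ < ENNReal.ofReal y → {i | y < ω i}.Finite := by
  have hrat (q : ℚ) : ∀ᵐ ω ∂expProduct θ, critPoint θ < ENNReal.ofReal q →
      {i | (Real.toNNReal q : ℝ) < ω i}.Finite :=
    eventually_imp_distrib_left.2 fun hq =>
      ae_expProduct_setOf_lt_finite hθ (expSum_lt_top_of_critPoint_lt hθ hq)
  filter_upwards [ae_all_iff.2 hrat] with ω hω y hy
  obtain ⟨q, -, hq, hqy⟩ := ENNReal.lt_iff_exists_rat_btwn.1 hy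
  have hle : (Real.toNNReal q : ℝ) ≤ y := by
    have hy0 := ENNReal.ofReal_pos.1 (zero_le.trans_lt hqy)
    rw [← Real.coe_toNNReal y hy0.le]
    exact NNReal.coe_le_coe.2 (ENNReal.coe_lt_coe.1 hqy).le
  exact (hω q hq).subset fun i hi => hle.trans_lt hi

end CriticalPoint

section Convergence

theorem measurableSet_topEvent {k : ℕ} (a : Fin (k + 1) → ℕ) (I : Set ℕ) :
    MeasurableSet (topEvent a I : Set (ℕ → ℝ)) := by
  refine (measurableSet_strictAnti.preimage
    (by fun_prop : Measurable fun (ω : ℕ → ℝ) j => ω (a j))).inter (measurableSet_setOfPred.2 ?_)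
  refine .forall fun i => .imp measurable_const (.imp measurable_const ?_)
  exact measurableSet_setOfPred.1 (measurableSet_lt (by fun_prop) (by fun_prop))

theorem isClopen_cylinderAt {k : ℕ} (a : Fin (k + 1) → ℕ) : IsClopen (cylinderAt a) := by
  have hinter : cylinderAt a = ⋂ j : Fin (k + 1), (fun s => s j) ⁻¹' {a j} := by
    ext
    simp [cylinderAt]
  rw [hinter]
  exact isClopen_iInter_of_finite fun j => (isClopen_discrete _).preimage (continuous_apply _)

variable {θ : ℕ → ℝ} (hθ : ∀ i, 0 < θ i)

include hθ

theorem ae_expProduct_exists_tendsto_sortedIndices (hc : critPoint θ < ∞)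
    (hf : expSum θ (critPoint θ).toNNReal = ∞) :
    ∀ᵐ ω ∂expProduct θ, ∃ s, Tendsto (fun n => sortedIndices n ω) atTop (𝓝 s) := by
  filter_upwards [ae_expProduct_injective hθ, ae_expProduct_setOf_lt_infinite hθ hf,
    ae_expProduct_setOf_lt_finite_of_critPoint_lt hθ] with ω hinj hinf hfin
  exact exists_tendsto_sortedIndices hinj hinf fun y hy =>
    hfin y ((ENNReal.lt_ofReal_iff_toReal_lt hc.ne).2 hy)

theorem exists_tendsto_reverseLuceLaw (hc : critPoint θ < ∞)
    (hf : expSum θ (critPoint θ).toNNReal = ∞) :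
    ∃ μ : ProbabilityMeasure (ℕ → ℕ), Tendsto (reverseLuceLaw θ hθ) atTop (𝓝 μ) := by
  have := isProbabilityMeasure_expProduct hθ
  have hmeas (n : ℕ) : AEMeasurable (sortedIndices n) (expProduct θ) :=
    (measurable_sortedIndices n).aemeasurable
  obtain ⟨s, hs, hlim⟩ := measurable_limit_of_tendsto_metrizable_ae hmeas
    (ae_expProduct_exists_tendsto_sortedIndices hθ hc hf)
  have hlaw (n : ℕ) : reverseLuceLaw θ hθ n =
      ⟨(expProduct θ).map (sortedIndices n), Measure.isProbabilityMeasure_map (hmeas n)⟩ :=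
    Subtype.ext (reverseLuceLaw_eq_map hθ n)
  rw [funext hlaw]
  exact ⟨_, (tendstoInDistribution_of_ae_tendsto hmeas hs.aemeasurable hlim).tendsto⟩

theorem reverseLuceLaw_cylinderAt {n k : ℕ} {a : Fin (k + 1) → ℕ} (ha : a.Injective)
    (han : ∀ j, a j < n) : (reverseLuceLaw θ hθ n : Measure (ℕ → ℕ)) (cylinderAt a) =
      expProduct θ (topEvent a (Set.Iio n)) := by
  rw [reverseLuceLaw_eq_map, Measure.map_apply (measurable_sortedIndices n)
    (isClopen_cylinderAt a).1.measurableSet]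
  refine measure_congr (eventuallyEq_set.2 ?_)
  filter_upwards [ae_expProduct_injective hθ] with ω hω
  exact sortedIndices_mem_cylinderAt_iff hω ha han

theorem tendsto_reverseLuceLaw_cylinderAt {k : ℕ} {a : Fin (k + 1) → ℕ} (ha : a.Injective) :
    Tendsto (fun n => (reverseLuceLaw θ hθ n : Measure (ℕ → ℕ)) (cylinderAt a)) atTop
      (𝓝 (expProduct θ (topEvent a Set.univ))) := by
  have := isProbabilityMeasure_expProduct hθ
  have hanti : Antitone fun n => (topEvent a (Set.Iio n) : Set (ℕ → ℝ)) :=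
    fun m n hmn ω hω => ⟨hω.1, fun i hi => hω.2 i (lt_of_lt_of_le hi hmn)⟩
  have hinter : ⋂ n, topEvent a (Set.Iio n) = (topEvent a Set.univ : Set (ℕ → ℝ)) := by
    ext ω
    simp only [topEvent, Set.mem_iInter, Set.mem_ofPred_eq]
    exact ⟨fun h => ⟨(h 0).1, fun i _ => (h (i + 1)).2 i i.lt_succ_self⟩,
      fun h n => ⟨h.1, fun i _ => h.2 i trivial⟩⟩
  have hlim := tendsto_measure_iInter_atTop (μ := expProduct θ)
    (fun n => (measurableSet_topEvent a (Set.Iio n)).nullMeasurableSet) hanti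
    ⟨0, measure_ne_top _ _⟩
  rw [hinter] at hlim
  refine hlim.congr' ?_
  filter_upwards [eventually_all.2 fun j => eventually_gt_atTop (a j)] with n han
  exact (reverseLuceLaw_cylinderAt hθ ha han).symm

variable {μ : ProbabilityMeasure (ℕ → ℕ)} (hμ : Tendsto (reverseLuceLaw θ hθ) atTop (𝓝 μ))

include hμ

theorem measure_cylinderAt_of_tendsto {k : ℕ} {a : Fin (k + 1) → ℕ} (ha : a.Injective) :
    (μ : Measure (ℕ → ℕ)) (cylinderAt a) = expProduct θ (topEvent a Set.univ) := by
  have hfrontier : (μ : Measure (ℕ → ℕ)) (frontier (cylinderAt a)) = 0 := by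
    rw [(isClopen_cylinderAt a).frontier_eq, measure_empty]
  exact tendsto_nhds_unique
    (ProbabilityMeasure.tendsto_measure_of_null_frontier_of_tendsto' hμ hfrontier)
    (tendsto_reverseLuceLaw_cylinderAt hθ ha)

theorem ae_expProduct_exists_max : ∀ᵐ ω ∂expProduct θ, ∃ i, ∀ j, ω j ≤ ω i := by
  have := isProbabilityMeasure_expProduct hθ
  let first (i : ℕ) : Fin 1 → ℕ := fun _ => i
  have hmax {i : ℕ} {ω : ℕ → ℝ} (hω : ω ∈ topEvent (first i) Set.univ) (j : ℕ) (hj : j ≠ i) :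
      ω j < ω i :=
    hω.2 j trivial fun ⟨_, h⟩ => hj h.symm
  have hdisj : Pairwise (Function.onFun Disjoint
      fun i => (topEvent (first i) Set.univ : Set (ℕ → ℝ))) := fun i j hij =>
    Set.disjoint_left.2 fun ω hi hj => (hmax hi j hij.symm).asymm (hmax hj i hij)
  have hcover : ⋃ i, cylinderAt (first i) = Set.univ :=
    Set.eq_univ_of_forall fun s => Set.mem_iUnion.2 ⟨s 0, fun j => by simp [first]⟩
  have hone : expProduct θ (⋃ i, topEvent (first i) Set.univ) = 1 := by
    refine le_antisymm prob_le_one ?_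
    rw [measure_iUnion hdisj fun i => measurableSet_topEvent _ _,
      ← measure_univ (μ := (μ : Measure (ℕ → ℕ))), ← hcover]
    refine (measure_iUnion_le _).trans_eq (tsum_congr fun i => ?_)
    exact measure_cylinderAt_of_tendsto hθ hμ fun _ _ _ => Subsingleton.elim (α := Fin 1) _ _
  filter_upwards [(mem_ae_iff_prob_eq_one
    (.iUnion fun i => measurableSet_topEvent (first i) Set.univ)).2 hone] with ω hω
  obtain ⟨i, hi⟩ := Set.mem_iUnion.1 hω
  exact ⟨i, fun j => (eq_or_ne j i).elim (fun h => h ▸ le_rfl) fun h => (hmax hi j h).le⟩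

theorem ae_expProduct_exists_max_ge_critPoint :
    ∀ᵐ ω ∂expProduct θ, ∃ i, critPoint θ ≤ ENNReal.ofReal (ω i) := by
  filter_upwards [ae_expProduct_exists_max hθ hμ, ae_expProduct_exists_lt_of_lt_critPoint hθ]
    with ω ⟨i, hi⟩ hlt
  refine ⟨i, le_of_not_gt fun h => ?_⟩
  obtain ⟨j, hj⟩ := hlt _ h
  exact (hi j).not_gt hj

theorem critPoint_lt_top_of_tendsto : critPoint θ < ∞ := by
  have := isProbabilityMeasure_expProduct hθ
  obtain ⟨ω, i, hi⟩ := (ae_expProduct_exists_max_ge_critPoint hθ hμ).exists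
  exact hi.trans_lt ENNReal.ofReal_lt_top

theorem expSum_critPoint_of_tendsto : expSum θ (critPoint θ).toNNReal = ∞ := by
  have hexp := fun i => isProbabilityMeasure_expMeasure (hθ i)
  set c := (critPoint θ).toNNReal
  by_contra hne
  have hc0 : 0 < c := pos_iff_ne_zero.2 fun h => hne (h ▸ expSum_zero θ)
  have hpos (i : ℕ) : expMeasure (θ i) (Set.Iic c) ≠ 0 := by
    rw [expMeasure_Iic (hθ i) c.coe_nonneg]
    refine (ENNReal.ofReal_pos.2 (sub_pos.2 (Real.exp_lt_one_iff.2 ?_))).ne'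
    exact mul_neg_of_neg_of_pos (neg_neg_iff_pos.2 (hθ i)) hc0
  have hle : expProduct θ (Set.univ.pi fun _ => Set.Iic (c : ℝ)) ≠ 0 := by
    refine infinitePi_univ_pi_ne_zero (fun _ => measurableSet_Iic) hpos ?_
    simpa only [Set.compl_Iic, tsum_expMeasure_Ioi hθ] using hne
  refine hle (measure_eq_zero_iff_ae_notMem.2 ?_)
  have hnec : ∀ᵐ ω ∂expProduct θ, ∀ i, ω i ≠ (c : ℝ) := ae_infinitePi_ne _
  filter_upwards [ae_expProduct_exists_max_ge_critPoint hθ hμ, hnec, ae_expProduct_pos hθ]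
    with ω ⟨i, hi⟩ hne hpos hω
  exact hne i ((hω i trivial).antisymm (ENNReal.toReal_le_of_le_ofReal (hpos i).le hi))

end Convergence

section TopEvent

theorem map_infinitePi_prodMk {ι κ X : Type*} [Fintype κ] [MeasurableSpace X] (ν : ι → Measure X)
    [∀ i, IsProbabilityMeasure (ν i)] {a : κ → ι} (ha : a.Injective) :
    (Measure.infinitePi ν).map
        (fun ω => (fun j => ω (a j), fun i : {i // i ∉ Set.range a} => ω i)) =
      (Measure.pi fun j => ν (a j)).prod
        (Measure.infinitePi fun i : {i // i ∉ Set.range a} => ν i) := by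
  classical
  have hindep : iIndepFun (fun i (ω : ι → X) => ω i) (Measure.infinitePi ν) :=
    iIndepFun_infinitePi (X := fun _ x => x) fun _ => measurable_id
  have hpair : IndepFun (fun (ω : ι → X) j => ω (a j))
      (fun (ω : ι → X) (i : {i // i ∉ Set.range a}) => ω i) (Measure.infinitePi ν) := by
    refine IndepFun.indepFun_process (by fun_prop) (fun i => by fun_prop) fun J => ?_
    have hdisj : Disjoint (Finset.univ.image a) (J.map (Function.Embedding.subtype _)) := by
      rw [Finset.disjoint_left]
      rintro i hi hiJ
      obtain ⟨l, -, rfl⟩ := Finset.mem_map.1 hiJ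
      exact l.2 (by simpa using hi)
    exact (hindep.indepFun_finset _ _ hdisj fun i => measurable_pi_apply i).comp
      (φ := fun z j => z ⟨a j, Finset.mem_image_of_mem a (Finset.mem_univ j)⟩)
      (ψ := fun z (i : J) => z ⟨i, Finset.mem_map_of_mem _ i.2⟩)
      (by fun_prop) (by fun_prop)
  rw [hpair.map_prod_eq_prod_map_map (Measurable.aemeasurable (by fun_prop))
      (Measurable.aemeasurable (by fun_prop)),
    Measure.map_infinitePi_infinitePi_of_inj ha,
    Measure.map_infinitePi_infinitePi_of_inj Subtype.val_injective, Measure.infinitePi_eq_pi]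

variable (ν : ℕ → Measure ℝ) {k : ℕ} (a : Fin (k + 1) → ℕ)

/-- The probability that all coordinates with index outside `Set.range a` are below `t`, for
independent coordinates with laws `ν i`. -/
def restBelow (t : ℝ) : ℝ≥0∞ :=
  Measure.infinitePi (fun i : {i // i ∉ Set.range a} => ν i) (Set.univ.pi fun _ => Set.Iio t)

theorem measurable_restBelow : Measurable (restBelow ν a) :=
  Monotone.measurable fun _ _ hst => measure_mono (Set.pi_mono fun _ _ => Set.Iio_subset_Iio hst)

theorem infinitePi_topEvent [∀ i, IsProbabilityMeasure (ν i)] {a : Fin (k + 1) → ℕ}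
    (ha : a.Injective) : Measure.infinitePi ν (topEvent a Set.univ) =
      ∫⁻ x in {x | StrictAnti x}, restBelow ν a (x (Fin.last k)) ∂Measure.pi fun j => ν (a j) := by
  let S : Set ((Fin (k + 1) → ℝ) × ({i // i ∉ Set.range a} → ℝ)) :=
    {p | StrictAnti p.1 ∧ ∀ i, p.2 i < p.1 (Fin.last k)}
  have hS : MeasurableSet S := by
    refine (measurable_fst measurableSet_strictAnti).inter (measurableSet_setOfPred.2 ?_)
    exact .forall fun i => measurableSet_setOfPred.1 (measurableSet_lt (by fun_prop) (by fun_prop))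
  have hpreimage : topEvent a Set.univ = (fun ω : ℕ → ℝ =>
      (fun j => ω (a j), fun i : {i // i ∉ Set.range a} => ω i)) ⁻¹' S := by
    ext ω
    simp [S, topEvent, Function.comp_def]
  have hsection (x : Fin (k + 1) → ℝ) :
      Measure.infinitePi (fun i : {i // i ∉ Set.range a} => ν i) (Prod.mk x ⁻¹' S) =
        {x | StrictAnti x}.indicator (fun x => restBelow ν a (x (Fin.last k))) x := by
    by_cases hx : StrictAnti x
    · rw [Set.indicator_of_mem hx, restBelow]
      congr 1
      ext w
      simp [S, hx]
    · have hempty : Prod.mk x ⁻¹' S = ∅ := by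
        ext w
        simp [S, hx]
      rw [Set.indicator_of_notMem hx, hempty, measure_empty]
  rw [hpreimage, ← Measure.map_apply (by fun_prop) hS, map_infinitePi_prodMk ν ha,
    Measure.prod_apply hS, lintegral_congr hsection, lintegral_indicator measurableSet_strictAnti]

end TopEvent

section LimitDensity

theorem measurableSet_decreasingRegion (k : ℕ) : MeasurableSet (decreasingRegion k) :=
  measurableSet_strictAnti.inter (measurableSet_lt measurable_const (measurable_pi_apply _))

variable {θ : ℕ → ℝ} {k : ℕ} {a : Fin (k + 1) → ℕ}

variable (θ a) in
/-- The integrand `limitIntegrand θ a` as a probability density: the joint density of the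
coordinates `a 0, …, a k` times the probability that the others are below the last of them. -/
def limitDensity (x : Fin (k + 1) → ℝ) : ℝ≥0∞ :=
  (∏ j, exponentialPDF (θ (a j)) (x j)) * restBelow (fun i => expMeasure (θ i)) a (x (Fin.last k))

theorem measurable_limitDensity : Measurable (limitDensity θ a) :=
  (measurable_prod_exponentialPDF _).mul ((measurable_restBelow _ a).comp (measurable_pi_apply _))

variable (hθ : ∀ i, 0 < θ i)

include hθ

theorem toReal_restBelow_expMeasure {t : ℝ} (ht : 0 ≤ t) :
    (restBelow (fun i => expMeasure (θ i)) a t).toReal =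
      ∏' i : {i // i ∉ Set.range a}, (1 - Real.exp (-θ i * t)) := by
  have := fun i => isProbabilityMeasure_expMeasure (hθ i)
  rw [restBelow, Measure.infinitePi_pi_univ _ fun _ => measurableSet_Iio,
    toReal_tprod_of_le_one fun _ => prob_le_one]
  refine tprod_congr fun i => ?_
  have hexp : Real.exp (-θ i * t) ≤ 1 := Real.exp_le_one_iff.2 (by nlinarith [hθ i])
  rw [measure_congr Iio_ae_eq_Iic, expMeasure_Iic (hθ i) ht, ENNReal.toReal_ofReal (by linarith)]

theorem toReal_limitDensity {x : Fin (k + 1) → ℝ} (hx : x ∈ decreasingRegion k) :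
    (limitDensity θ a x).toReal = limitIntegrand θ a x := by
  have hnonneg (j : Fin (k + 1)) : 0 ≤ x j := hx.2.le.trans (hx.1.antitone j.le_last)
  rw [limitDensity, limitIntegrand, ENNReal.toReal_mul, ENNReal.toReal_prod,
    toReal_restBelow_expMeasure hθ hx.2.le]
  congr 1
  refine Finset.prod_congr rfl fun j _ => ?_
  rw [exponentialPDF_of_nonneg (hnonneg j), neg_mul,
    ENNReal.toReal_ofReal (mul_nonneg (hθ _).le (Real.exp_nonneg _))]

theorem setOf_strictAnti_ae_eq_decreasingRegion :
    {x : Fin (k + 1) → ℝ | StrictAnti x} =ᵐ[Measure.pi fun j => expMeasure (θ (a j))]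
      decreasingRegion k := by
  have := fun i => isProbabilityMeasure_expMeasure (hθ i)
  have hpos := (Measure.quasiMeasurePreserving_eval (fun j => expMeasure (θ (a j)))
    (Fin.last k)).ae (expMeasure_ae_pos (hθ _))
  refine eventuallyEq_set.2 (hpos.mono fun x hx => ?_)
  exact (and_iff_left hx).symm

theorem expProduct_topEvent (ha : a.Injective) :
    expProduct θ (topEvent a Set.univ) = ∫⁻ x in decreasingRegion k, limitDensity θ a x := by
  have := fun i => isProbabilityMeasure_expMeasure (hθ i)
  have hrest : Measurable fun x : Fin (k + 1) → ℝ =>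
      restBelow (fun i => expMeasure (θ i)) a (x (Fin.last k)) :=
    (measurable_restBelow _ a).comp (measurable_pi_apply _)
  rw [expProduct, infinitePi_topEvent _ ha,
    setLIntegral_congr (setOf_strictAnti_ae_eq_decreasingRegion hθ),
    pi_expMeasure_eq_withDensity fun j => hθ (a j),
    setLIntegral_withDensity_eq_setLIntegral_mul _ (measurable_prod_exponentialPDF _) hrest
      (measurableSet_decreasingRegion k)]
  rfl

theorem setLIntegral_limitDensity_ne_top (ha : a.Injective) :
    ∫⁻ x in decreasingRegion k, limitDensity θ a x ≠ ∞ := by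
  have := isProbabilityMeasure_expProduct hθ
  rw [← expProduct_topEvent hθ ha]
  exact measure_ne_top _ _

theorem integrableOn_limitIntegrand (ha : a.Injective) :
    IntegrableOn (limitIntegrand θ a) (decreasingRegion k) :=
  (integrableOn_congr_fun (fun _ hx => toReal_limitDensity hθ hx)
    (measurableSet_decreasingRegion k)).1 (integrable_toReal_of_lintegral_ne_top
      measurable_limitDensity.aemeasurable (setLIntegral_limitDensity_ne_top hθ ha))

theorem setIntegral_limitIntegrand (ha : a.Injective) :
    ∫ x in decreasingRegion k, limitIntegrand θ a x =
      (expProduct θ).real (topEvent a Set.univ) := by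
  have hfinite := ae_lt_top measurable_limitDensity (setLIntegral_limitDensity_ne_top hθ ha)
  rw [measureReal_def, expProduct_topEvent hθ ha,
    ← integral_toReal measurable_limitDensity.aemeasurable hfinite]
  exact (setIntegral_congr_fun (measurableSet_decreasingRegion k) fun _ hx =>
    toReal_limitDensity hθ hx).symm

end LimitDensity

end

theorem theorem4p2_general (θ : ℕ → ℝ) (hpos : ∀ i, 0 < θ i) :
    ((∃ μ : ProbabilityMeasure (ℕ → ℕ), Tendsto (reverseLuceLaw θ hpos) atTop (𝓝 μ)) ↔
      critPoint θ < ∞ ∧ expSum θ (critPoint θ).toNNReal = ∞) ∧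
    ∀ (k : ℕ) (a : Fin (k + 1) → ℕ), Function.Injective a →
      IntegrableOn (limitIntegrand θ a) (decreasingRegion k) ∧
      Tendsto (fun n => (reverseLuceLaw θ hpos n : Measure (ℕ → ℕ)).real (cylinderAt a)) atTop
        (𝓝 (∫ x in decreasingRegion k, limitIntegrand θ a x)) ∧
      ∀ μ : ProbabilityMeasure (ℕ → ℕ), Tendsto (reverseLuceLaw θ hpos) atTop (𝓝 μ) →
        (μ : Measure (ℕ → ℕ)).real (cylinderAt a) =
          ∫ x in decreasingRegion k, limitIntegrand θ a x := by
  refine ⟨⟨fun ⟨_, hμ⟩ => ⟨critPoint_lt_top_of_tendsto hpos hμ,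
    expSum_critPoint_of_tendsto hpos hμ⟩, fun h => exists_tendsto_reverseLuceLaw hpos h.1 h.2⟩,
    fun k a ha => ⟨integrableOn_limitIntegrand hpos ha, ?_, fun μ hμ => ?_⟩⟩
  · have := isProbabilityMeasure_expProduct hpos
    rw [setIntegral_limitIntegrand hpos ha]
    exact (ENNReal.tendsto_toReal (measure_ne_top _ _)).comp
      (tendsto_reverseLuceLaw_cylinderAt hpos ha)
  · rw [setIntegral_limitIntegrand hpos ha, measureReal_def,
      measure_cylinderAt_of_tendsto hpos hμ ha, measureReal_def]

theorem theorem4p2 (θ : ℕ → ℝ) (hpos : ∀ i, 0 < θ i) (hmono : Monotone θ) :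
    ((∃ μ : ProbabilityMeasure (ℕ → ℕ), Tendsto (reverseLuceLaw θ hpos) atTop (𝓝 μ)) ↔
      critPoint θ < ∞ ∧ expSum θ (critPoint θ).toNNReal = ∞) ∧
    (critPoint θ < ∞ ∧ expSum θ (critPoint θ).toNNReal = ∞ →
      ∀ (k : ℕ) (a : Fin (k + 1) → ℕ), Function.Injective a →
        IntegrableOn (limitIntegrand θ a) (decreasingRegion k) ∧
        Tendsto (fun n => (reverseLuceLaw θ hpos n : Measure (ℕ → ℕ)).real (cylinderAt a)) atTop
          (𝓝 (∫ x in decreasingRegion k, limitIntegrand θ a x)) ∧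
        ∀ μ : ProbabilityMeasure (ℕ → ℕ), Tendsto (reverseLuceLaw θ hpos) atTop (𝓝 μ) →
          (μ : Measure (ℕ → ℕ)).real (cylinderAt a) =
            ∫ x in decreasingRegion k, limitIntegrand θ a x) :=
  ⟨(theorem4p2_general θ hpos).1, fun _ => (theorem4p2_general θ hpos).2⟩
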